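/- Let $\mathbb K\in\{\mathbb R,\mathbb C\}$, let $\Omega\subset\mathbb R^d$ be open, and let $V$ be a Hilbert space of $\mathbb K^m$-valued functions on $\Omega$ (a Sobolev space such as $H^1_0(\Omega)^m$) that is compactly embedded in $L^2(\Omega)=L^2(\Omega;\mathbb K^m)$. Let $\mathcal L$ be the operator of a bounded sesquilinear form $a$ on $V$, $a(u,v)=(\mathcal Lu,v)_{L^2(\Omega)}$, which is Hermitian and uniformly positive definite: $a(v,v)\ge c\|v\|_V^2$ for some $c>0$ and all $v\in V$. Put $\|v\|_a=\sqrt{a(v,v)}$. Let $\omega_1,\dots,\omega_{N_c}$ be open sets with $\bigcup_i\omega_i=\Omega$, and let $V(\omega_i)=\{v\in V: v=0\text{ a.e. in }\Omega\setminus\omega_i\}$. For $w\in V(\omega_i)$ and $g\in L^2(\Omega)$ write $\mathcal L w=g$ in $\omega_i$ if $a(w,v)=(g,v)_{L^2(\Omega)}$ for all $v\in V(\omega_i)$. The spaces $V(\omega_i)$ are assumed infinite-dimensional. For each $i$ let $(\lambda_i^j,\phi_i^j)_{j\ge1}$ be all eigenpairs of the local inverse operator $\mathcal L_i^{-1}$,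 that is, $\phi_i^j\in V(\omega_i)$ and $\mathcal L(\lambda_i^j\phi_i^j)=\phi_i^j$ in $\omega_i$, counted with multiplicity, ordered so that $\lambda_i^1\ge\lambda_i^2\ge\cdots$, with $(\phi_i^j)_j$ orthonormal in $L^2(\Omega)$. Let $L_i\ge1$ be integers and $$\lambda^{L+1}=\max_i\lambda_i^{L_i+1},\qquad \Gamma=\min_{1\le i\le N_c,\ 1\le j\le L_i}\frac{\lambda_i^j-\lambda_i^{j+1}}{\lambda_i^{j+1}} .$$ For each $i$ let $\psi_i^0\in V(\omega_i)$ satisfy $(\psi_i^0,\phi_i^j)_{L^2(\Omega)}\ne0$ for $1\le j\le L_i$, and let $\psi_i^{n+1}\in V(\omega_i)$, $\mu_i^{n+1}\in\mathbb K$ $(n\ge0)$ be given by $$a(\psi_i^{n+1},v)+\mu_i^{n+1}(\psi_i^n,v)_{L^2(\Omega)}=0\quad\text{for all }v\in V(\omega_i),\qquad (\psi_i^n,\psi_i^{n+1})_{L^2(\Omega)}=1 .$$ Let $V_K^n=\sum_{i=1}^{N_c}\operatorname{span}\{\psi_i^0,\dots,\psi_i^n\}$. Then there is a constant $C\ge0$,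 independent of $n$, $f$, $u$ and of the partition of unity, such that the following holds for every $n\ge0$, every $f\in L^2(\Omega)$ and every partition of unity $\chi_1,\dots,\chi_{N_c}\ge0$ with $\sum_i\chi_i=1$ on $\Omega$ and $\chi_i=0$ outside $\omega_i$. Let $u\in V$ be the weak solution of $\mathcal Lu=f$, i.e. $a(u,v)=(f,v)_{L^2(\Omega)}$ for all $v\in V$, and let $u_K\in V_K^n$ be the Galerkin solution, i.e. $a(u_K,v)=(f,v)_{L^2(\Omega)}$ for all $v\in V_K^n$. If $\chi_iu\in V$ and $\mathcal L\chi_iu\in L^2(\Omega)$ (in the sense above, in $\omega_i$) for all $i$, then $$\|u-u_K\|_a\le\sqrt{\lambda^{L+1}}\,\sum_{i=1}^{N_c}\|\mathcal L\chi_iu\|_{L^2(\Omega)}+C\Big(\frac1{1+4\Gamma}\Big)^n\|u\|_{L^2(\Omega)} .$$ -/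

import Mathlib

open MeasureTheory
open scoped InnerProductSpace ComplexConjugate

namespace LKSI

noncomputable section

/-- `L²(Ω)`: square integrable `𝕜^m`-valued functions on `Ω ⊆ ℝ^d`
(`m = 1` for diffusion, `m = d` for elasticity). -/
abbrev L2 (𝕜 : Type*) [RCLike 𝕜] (m : ℕ) {d : ℕ} (Ω : Set (EuclideanSpace ℝ (Fin d))) : Type _ :=
  Lp (EuclideanSpace 𝕜 (Fin m)) 2 (volume.restrict Ω)

variable {𝕜 : Type*} [RCLike 𝕜] {d m : ℕ} {Ω : Set (EuclideanSpace ℝ (Fin d))}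
variable {V : Type*} [NormedAddCommGroup V] [InnerProductSpace 𝕜 V]

/-- `V(ω)`: the functions in `V` that vanish (almost everywhere) on `Ω` outside `ω`.
`emb` is the embedding of `V` into `L²(Ω)`. -/
def localSpace (emb : V →L[𝕜] L2 𝕜 m Ω) (ω : Set (EuclideanSpace ℝ (Fin d))) :
    Submodule 𝕜 V where
  carrier := {v | ∀ᵐ x ∂(volume.restrict Ω), x ∉ ω → emb v x = 0}
  zero_mem' := by
    have h0 : emb 0 = 0 := map_zero emb
    rw [Set.mem_ofPred_eq, h0]
    filter_upwards [Lp.coeFn_zero (EuclideanSpace 𝕜 (Fin m)) 2 (volume.restrict Ω)] with x hx _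
    rw [hx, Pi.zero_apply]
  add_mem' := by
    intro u v hu hv
    rw [Set.mem_ofPred_eq] at *
    rw [map_add]
    filter_upwards [hu, hv, Lp.coeFn_add (emb u) (emb v)] with x h1 h2 h3 hx
    rw [h3, Pi.add_apply, h1 hx, h2 hx, add_zero]
  smul_mem' := by
    intro c v hv
    rw [Set.mem_ofPred_eq] at *
    rw [map_smul]
    filter_upwards [hv, Lp.coeFn_smul c (emb v)] with x h1 h2 hx
    rw [h2, Pi.smul_apply, h1 hx, smul_zero]

/-- A bounded sesquilinear form that is Hermitian and (uniformly) positive definite on `V`. -/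
structure IsSymmCoercive (a : V →L⋆[𝕜] V →L[𝕜] 𝕜) : Prop where
  hermitian : ∀ u v, a v u = conj (a u v)
  coercive : ∃ c : ℝ, 0 < c ∧ ∀ v, c * ‖v‖ ^ 2 ≤ RCLike.re (a v v)

/-- The energy norm `‖v‖_a = √(a(v,v))`. -/
def energyNorm (a : V →L⋆[𝕜] V →L[𝕜] 𝕜) (v : V) : ℝ := Real.sqrt (RCLike.re (a v v))

/-- `w` is the variational (Galerkin) solution in the subspace `W` with right-hand side `f`:
`w ∈ W` and `a(w, v) = (f, v)_{L²(Ω)}` for all `v ∈ W`.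
* `W = ⊤`: `w` is the weak solution of `𝓛 w = f`;
* `W = V(ω)`: `𝓛_ω w = f`, that is `w = 𝓛_ω⁻¹ f`, for the operator `𝓛_ω` restricted to `V(ω)`. -/
def IsVarSolution (emb : V →L[𝕜] L2 𝕜 m Ω) (a : V →L⋆[𝕜] V →L[𝕜] 𝕜)
    (W : Submodule 𝕜 V) (f : L2 𝕜 m Ω) (w : V) : Prop :=
  w ∈ W ∧ ∀ v ∈ W, a w v = ⟪f, emb v⟫_𝕜

/-- `(μ, w)` satisfies the local spectral problem `𝓛_ω⁻¹ w = μ w`, `w ∈ V(ω)`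
(`w = 0` is not excluded here). -/
def IsLocalEigen (emb : V →L[𝕜] L2 𝕜 m Ω) (a : V →L⋆[𝕜] V →L[𝕜] 𝕜)
    (ω : Set (EuclideanSpace ℝ (Fin d))) (μ : ℝ) (w : V) : Prop :=
  w ∈ localSpace emb ω ∧ IsVarSolution emb a (localSpace emb ω) (emb w) ((μ : 𝕜) • w)

/-- `(lam j, φ j)`, `j = 0, 1, 2, …`, is an enumeration of all eigenpairs of `𝓛_ω⁻¹` in `V(ω)`,
in non-increasing order of the eigenvalues, repeated by multiplicity, with `L²`-orthonormal
eigenfunctions. (The indices start at `0`, so `lam j` is the `(j+1)`-st eigenvalue.) -/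
structure IsLocalEigenSystem (emb : V →L[𝕜] L2 𝕜 m Ω) (a : V →L⋆[𝕜] V →L[𝕜] 𝕜)
    (ω : Set (EuclideanSpace ℝ (Fin d))) (lam : ℕ → ℝ) (φ : ℕ → V) : Prop where
  eigen : ∀ j, IsLocalEigen emb a ω (lam j) (φ j)
  orthonormal : Orthonormal 𝕜 fun j => emb (φ j)
  antitone : Antitone lam
  all_eigen : ∀ (μ : ℝ) (w : V), IsLocalEigen emb a ω μ w →
    w ∈ Submodule.span 𝕜 (φ '' {j | lam j = μ})

/-- The localized Krylov iteration on `ω`: `ψ 0 ∈ V(ω)`, and `ψ (n+1) ∈ V(ω)` solves, together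
with a multiplier `μ`, the saddle point problem with the functional `q n = (ψ n, ·)_{L²(Ω)}`. -/
structure IsKrylovIteration (emb : V →L[𝕜] L2 𝕜 m Ω) (a : V →L⋆[𝕜] V →L[𝕜] 𝕜)
    (ω : Set (EuclideanSpace ℝ (Fin d))) (ψ : ℕ → V) : Prop where
  mem : ∀ n, ψ n ∈ localSpace emb ω
  saddle : ∀ n, ∃ μ : 𝕜, ∀ v ∈ localSpace emb ω,
    a (ψ (n + 1)) v + μ * ⟪emb (ψ n), emb v⟫_𝕜 = 0
  normalized : ∀ n, ⟪emb (ψ n), emb (ψ (n + 1))⟫_𝕜 = 1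

/-- The multiscale space `V_K^n`: the sum over `i` of the local spaces `span {ψ_i^0, …, ψ_i^n}`. -/
def krylovSpace (𝕜 : Type*) [RCLike 𝕜] {V : Type*} [NormedAddCommGroup V]
    [InnerProductSpace 𝕜 V] {Nc : ℕ} (ψ : Fin Nc → ℕ → V) (n : ℕ) : Submodule 𝕜 V :=
  ⨆ i, Submodule.span 𝕜 (ψ i '' Set.Iic n)

/-- `χ` is a partition of unity on `Ω` subordinate to the family `ω`. -/
structure IsPartitionOfUnity {Nc : ℕ} (Ω : Set (EuclideanSpace ℝ (Fin d)))
    (ω : Fin Nc → Set (EuclideanSpace ℝ (Fin d)))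
    (χ : Fin Nc → EuclideanSpace ℝ (Fin d) → ℝ) : Prop where
  nonneg : ∀ i x, 0 ≤ χ i x
  sum_eq_one : ∀ x ∈ Ω, ∑ i, χ i x = 1
  eq_zero : ∀ i, ∀ x ∉ ω i, χ i x = 0

/-- `λ^{L+1} = max_i λ_i^{L_i+1}` (with eigenvalues indexed from `0`). -/
def lamMax {Nc : ℕ} (lam : Fin Nc → ℕ → ℝ) (L : Fin Nc → ℕ) : ℝ := ⨆ i, lam i (L i)

/-- The relative gap `(λ^j - λ^{j+1}) / λ^{j+1}` (with eigenvalues indexed from `0`). -/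
def relGap (lam : ℕ → ℝ) (j : ℕ) : ℝ := (lam j - lam (j + 1)) / lam (j + 1)

/-- `Γ`: the minimum of the relative gaps over all `i` and over the first `L_i` indices `j`. -/
def minGap {Nc : ℕ} (lam : Fin Nc → ℕ → ℝ) (L : Fin Nc → ℕ) : ℝ :=
  ⨅ p : (i : Fin Nc) × Fin (L i), relGap (lam p.1) p.2

end

end LKSI

/-! Galerkin solutions are best approximations in the energy norm, so it suffices to exhibit one
good element of $V_K^n$. As $u=\sum_i\chi_iu$, each piece $w_i=\chi_iu=G_ig_i$ can be treated alone,
$G_i$ being the solution operator on $V(\omega_i)$. Cutting the eigenexpansion of $w_i$ after $L_i$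
terms costs at most $\sqrt{\lambda_i^{L_i+1}}\,\|g_i\|$, because $\|Gg\|_a^2=(g,Gg)$
(`energyNorm_sub_sum_le`).

The first $L_i$ eigenfunctions remain. The saddle point problem makes $\psi^{n+1}$ a nonzero
multiple of $G\psi^n$, so the Krylov space contains $G\,P(S)\psi^0$ whenever $\deg P<n$, where $S$
is `emb ∘L G`. Take $P$ equal to one at $\lambda^j$, zero at the other leading eigenvalues, and
Chebyshev-small on $[0,\lambda^{L+1}]$ (`exists_filter_polynomial`). The spectral theorem for the
compact operator $S$ turns this into an error of order $(1+4\Gamma)^{-n}$ (`exists_krylov_approx`).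
The expansion coefficients are bounded by $\|\chi_iu\|\le\|u\|$. -/

namespace LKSI

/-! ### Growth of Chebyshev polynomials to the right of $[-1,1]$. -/

section Chebyshev

open Polynomial

/-- With $x=\cosh t$, $T_k(x)=\cosh kt\ge e^{kt}/2$. Since $\sinh^2t=x^2-1\ge(2\gamma)^2$,
$e^t=\cosh t+\sinh t\ge1+4\gamma$; this is the origin of the rate. -/
theorem half_pow_le_eval_chebyshev {γ x : ℝ} (hγ : 0 ≤ γ) (hx : 1 + 2 * γ ≤ x) (k : ℕ) :
    (1 + 4 * γ) ^ k / 2 ≤ (Chebyshev.T ℝ k).eval x := by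
  have hx1 : 1 ≤ x := by linarith
  set t := Real.arcosh x with ht
  have ht0 : 0 ≤ t := Real.arcosh_nonneg hx1
  have hc : Real.cosh t = x := Real.cosh_arcosh hx1
  have hs0 : 0 ≤ Real.sinh t := Real.sinh_nonneg_iff.2 ht0
  have hs : 2 * γ ≤ Real.sinh t := by
    have h := Real.cosh_sq t
    rw [hc] at h
    nlinarith
  have he : 1 + 4 * γ ≤ Real.exp t := by
    rw [← Real.cosh_add_sinh, hc]; linarith
  rw [← hc, Chebyshev.T_real_cosh, Real.cosh_eq]
  have h1 : (1 + 4 * γ) ^ k ≤ Real.exp (k * t) := by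
    rw [Real.exp_nat_mul]
    exact pow_le_pow_left₀ (by linarith) he k
  have h2 := Real.exp_pos (-(k * t))
  push_cast
  linarith

end Chebyshev

/-! ### Polynomials of compact symmetric operators. -/

section Spectral

open Polynomial Module.End

variable {𝕜 : Type*} [RCLike 𝕜] {K : Type*} [NormedAddCommGroup K] [InnerProductSpace 𝕜 K]

/-- A polynomial of a compact symmetric operator is bounded by its values on the eigenvalues. -/
theorem norm_aeval_le_of_isCompactOperator [CompleteSpace K] {T : K →L[𝕜] K}
    (hT : IsCompactOperator T) (hsymm : T.IsSymmetric) (p : ℝ[X]) {B : ℝ}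
    (hB : ∀ (μ : ℝ) (x : K), x ≠ 0 → T x = (μ : 𝕜) • x → |p.eval μ| ≤ B) (x : K) :
    ‖aeval (T : Module.End 𝕜 K) (p.map (algebraMap ℝ 𝕜)) x‖ ≤ B * ‖x‖ := by
  classical
  set P : 𝕜[X] := p.map (algebraMap ℝ 𝕜) with hP
  by_cases hx0 : x = 0
  · simp [hx0]
  have hcont : Continuous (aeval (T : Module.End 𝕜 K) P) := by
    have h : ∀ Q : 𝕜[X], Continuous (aeval (T : Module.End 𝕜 K) Q) := by
      intro Q
      induction Q using Polynomial.induction_on with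
      | C c => 
        rw [aeval_C, Algebra.algebraMap_eq_smul_one]
        exact continuous_const_smul c
      | add q r hq hr => rw [map_add]; exact hq.add hr
      | monomial n c h =>
        rw [pow_succ, ← mul_assoc, map_mul, aeval_X]
        exact h.comp T.continuous
    exact h P
  -- By the spectral theorem it is enough to prove the bound on finite sums of eigenvectors, by
  -- Pythagoras, and pass to the closure.
  have hdense : Dense ((⨆ μ, eigenspace (T : Module.End 𝕜 K) μ : Submodule 𝕜 K) : Set K) := by
    rw [Submodule.dense_iff_topologicalClosure_eq_top, Submodule.topologicalClosure_eq_top_iff]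
    exact ContinuousLinearMap.orthogonalComplement_iSup_eigenspaces_eq_bot hT hsymm
  have key : ∀ y ∈ (⨆ μ, eigenspace (T : Module.End 𝕜 K) μ : Submodule 𝕜 K), y ≠ 0 →
      ‖aeval (T : Module.End 𝕜 K) P y‖ ≤ B * ‖y‖ := by
    intro y hy hy0
    obtain ⟨f, hf, rfl⟩ := (Submodule.mem_iSup_iff_exists_finsupp _ _).1 hy
    have hev : ∀ μ, ‖P.eval μ • f μ‖ ≤ B * ‖f μ‖ := by
      intro μ
      by_cases h0 : f μ = 0
      · simp [h0]
      have he : HasEigenvector (T : Module.End 𝕜 K) μ (f μ) := ⟨hf μ, h0⟩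
      have hreal : ((RCLike.re μ : ℝ) : 𝕜) = μ :=
        RCLike.conj_eq_iff_re.1 (hsymm.conj_eigenvalue_eq_self (hasEigenvalue_of_hasEigenvector he))
      have h2 : P.eval μ = ((p.eval (RCLike.re μ) : ℝ) : 𝕜) := by
        conv_lhs => rw [← hreal]
        rw [hP, eval_map_algebraMap]
        exact aeval_algebraMap_apply 𝕜 (RCLike.re μ) p
      rw [norm_smul, h2, RCLike.norm_ofReal]
      refine mul_le_mul_of_nonneg_right (hB _ (f μ) h0 ?_) (norm_nonneg _)
      rw [hreal]
      exact mem_eigenspace_iff.1 (hf μ)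
    -- The sign of `B` is not assumed: a negative `B` would exclude all eigenvectors and force `y =
    -- 0`.
    have hBnonneg : 0 ≤ B := by
      by_contra hneg
      have : ∀ μ, f μ = 0 := by
        intro μ
        by_contra h
        have h1 := hev μ
        have h2 := norm_nonneg (P.eval μ • f μ)
        have h3 := norm_pos_iff.2 h
        nlinarith
      exact hy0 (by simp [Finsupp.sum, this])
    have hort := hsymm.orthogonalFamily_eigenspaces
    have e1 : aeval (T : Module.End 𝕜 K) P (f.sum fun _ z => z)
        = ∑ μ ∈ f.support, P.eval μ • f μ := by
      rw [Finsupp.sum, map_sum]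
      refine Finset.sum_congr rfl fun μ hμ => ?_
      exact aeval_apply_of_hasEigenvector ⟨hf μ, Finsupp.mem_support_iff.1 hμ⟩
    have n1 := hort.norm_sum (fun μ => ⟨f μ, hf μ⟩) f.support
    have n2 := hort.norm_sum (fun μ => P.eval μ • (⟨f μ, hf μ⟩ : eigenspace _ μ)) f.support
    simp only [Submodule.coe_subtypeₗᵢ, Submodule.coe_norm, Submodule.coe_smul,
      Submodule.subtype_apply] at n1 n2
    refine abs_le_of_sq_le_sq' ?_ (by positivity) |>.2
    rw [e1, mul_pow, Finsupp.sum]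
    rw [n1, n2, Finset.mul_sum]
    refine Finset.sum_le_sum fun μ _ => ?_
    rw [← mul_pow]
    exact pow_le_pow_left₀ (norm_nonneg _) (hev μ) 2
  have hcl : IsClosed {y : K | ‖aeval (T : Module.End 𝕜 K) P y‖ ≤ B * ‖y‖} :=
    isClosed_le hcont.norm (continuous_const.mul continuous_norm)
  have hsub : ((⨆ μ, eigenspace (T : Module.End 𝕜 K) μ : Submodule 𝕜 K) : Set K) ⊆
      {y : K | ‖aeval (T : Module.End 𝕜 K) P y‖ ≤ B * ‖y‖} := by
    intro y hy
    by_cases hy0 : y = 0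
    · simp [hy0]
    · exact key y hy hy0
  exact hcl.closure_subset_iff.2 hsub (hdense x)

/-- The same bound on a closed invariant subspace. -/
theorem norm_aeval_le_of_mem_invariant [CompleteSpace K] {T : K →L[𝕜] K}
    (hT : IsCompactOperator T) (hsymm : T.IsSymmetric) {N : Submodule 𝕜 K}
    (hNc : IsClosed (N : Set K)) (hN : ∀ x ∈ N, T x ∈ N) (p : ℝ[X]) {B : ℝ}
    (hB : ∀ (μ : ℝ), ∀ x ∈ N, x ≠ 0 → T x = (μ : 𝕜) • x → |p.eval μ| ≤ B) {x : K} (hx : x ∈ N) :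
    ‖aeval (T : Module.End 𝕜 K) (p.map (algebraMap ℝ 𝕜)) x‖ ≤ B * ‖x‖ := by
  have : CompleteSpace N := hNc.completeSpace_coe
  let R : N →L[𝕜] N := T.restrict hN
  have hR : IsCompactOperator R := hT.restrict' hN
  have hRs : R.IsSymmetric := hsymm.restrict_invariant hN
  have hcoe : ∀ (Q : 𝕜[X]) (y : N), ((aeval (R : Module.End 𝕜 N) Q y : N) : K)
      = aeval (T : Module.End 𝕜 K) Q (y : K) := by
    intro Q
    induction Q using Polynomial.induction_on with
    | C c => intro y; simp [Algebra.algebraMap_eq_smul_one]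
    | add q r hq hr => intro y; simp [map_add, hq, hr]
    | monomial n c h =>
      intro y
      rw [pow_succ, ← mul_assoc, map_mul, map_mul (aeval (T : Module.End 𝕜 K)), aeval_X, aeval_X]
      exact h (R y)
  have := norm_aeval_le_of_isCompactOperator hR hRs p (B := B) (fun μ y hy h => by
    refine hB μ y y.2 (by simpa using hy) ?_
    exact congrArg Subtype.val h) ⟨x, hx⟩
  rw [Submodule.coe_norm, hcoe] at this
  simpa using this

end Spectral

/-! ### Lax–Milgram and the local solution operators. -/

section SolutionOperator

variable {𝕜 : Type*} [RCLike 𝕜] {K : Type*} [NormedAddCommGroup K] [InnerProductSpace 𝕜 K]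
variable {V : Type*} [NormedAddCommGroup V] [InnerProductSpace 𝕜 V]

/-- `G` is the solution operator of the variational problem in the subspace `W`. -/
structure IsSolutionOperator (emb : V →L[𝕜] K) (a : V →L⋆[𝕜] V →L[𝕜] 𝕜)
    (W : Submodule 𝕜 V) (G : K →L[𝕜] V) : Prop where
  mem : ∀ f, G f ∈ W
  eq : ∀ f, ∀ v ∈ W, a (G f) v = ⟪f, emb v⟫_𝕜

theorem IsSymmCoercive.re_self_nonneg {a : V →L⋆[𝕜] V →L[𝕜] 𝕜} (ha : IsSymmCoercive a) (v : V) :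
    0 ≤ RCLike.re (a v v) := by
  obtain ⟨c, hc, h⟩ := ha.coercive
  exact le_trans (by positivity) (h v)

theorem IsSymmCoercive.eq_zero {a : V →L⋆[𝕜] V →L[𝕜] 𝕜} (ha : IsSymmCoercive a) {v : V}
    (hv : a v v = 0) : v = 0 := by
  obtain ⟨c, hc, h⟩ := ha.coercive
  have h1 := h v
  rw [hv, map_zero] at h1
  have h2 : ‖v‖ ^ 2 ≤ 0 := by nlinarith [sq_nonneg ‖v‖]
  simpa using le_antisymm h2 (sq_nonneg _)

/-- A coercive form on a Hilbert space is represented by an invertible operator. -/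
theorem bijective_continuousLinearMapOfBilin [CompleteSpace V] {a : V →L⋆[𝕜] V →L[𝕜] 𝕜}
    (ha : IsSymmCoercive a) :
    Function.Bijective (InnerProductSpace.continuousLinearMapOfBilin a) := by
  set A := InnerProductSpace.continuousLinearMapOfBilin a with hA
  obtain ⟨c, hc, h⟩ := ha.coercive
  -- Coercivity and Cauchy–Schwarz bound `A` below, which gives injectivity and closed range.
  have hbd : ∀ v, ‖v‖ ≤ (⟨c⁻¹, by positivity⟩ : NNReal) * ‖A v‖ := by
    intro v
    rcases eq_or_ne v 0 with rfl | hv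
    · simp
    have h1 : c * ‖v‖ ^ 2 ≤ ‖A v‖ * ‖v‖ := by
      refine (h v).trans ?_
      rw [← InnerProductSpace.continuousLinearMapOfBilin_apply a v v]
      exact re_inner_le_norm (A v) v
    have h2 := norm_pos_iff.2 hv
    have h3 : c * ‖v‖ ≤ ‖A v‖ := by nlinarith
    change ‖v‖ ≤ c⁻¹ * ‖A v‖
    rw [le_inv_mul_iff₀ hc]
    exact h3
  have hanti := ContinuousLinearMap.antilipschitz_of_bound A hbd
  refine ⟨hanti.injective, ?_⟩
  have hcl : IsClosed (A.range : Set V) := hanti.isClosed_range A.uniformContinuous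
  have : CompleteSpace A.range := hcl.completeSpace_coe
  have htop : A.range = ⊤ := by
    rw [← A.range.orthogonal_orthogonal, Submodule.eq_top_iff']
    intro v w hw
    have hw0 : w = 0 := ha.eq_zero (by
      rw [← InnerProductSpace.continuousLinearMapOfBilin_apply a w w]
      exact hw _ ⟨w, rfl⟩)
    rw [hw0, inner_zero_left]
  exact LinearMap.range_eq_top.1 htop

/-- Lax–Milgram on the Hilbert space `W`: the adjoint of the restricted embedding sends `f` to the
Riesz representative of $v\mapsto(f,v)$, and `A.symm` then solves the equation. -/
theorem exists_isSolutionOperator [CompleteSpace V] [CompleteSpace K] (emb : V →L[𝕜] K)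
    {a : V →L⋆[𝕜] V →L[𝕜] 𝕜} (ha : IsSymmCoercive a) {W : Submodule 𝕜 V}
    (hW : IsClosed (W : Set V)) : ∃ G : K →L[𝕜] V, IsSolutionOperator emb a W G := by
  have : CompleteSpace W := hW.completeSpace_coe
  let aW : W →L⋆[𝕜] W →L[𝕜] 𝕜 := a.bilinearComp W.subtypeL W.subtypeL
  have haW : IsSymmCoercive aW := by
    refine ⟨fun u v => ha.hermitian u v, ?_⟩
    obtain ⟨c, hc, h⟩ := ha.coercive
    exact ⟨c, hc, fun v => h v⟩
  have hb := bijective_continuousLinearMapOfBilin haW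
  let A : W ≃L[𝕜] W := ContinuousLinearEquiv.ofBijective
    (InnerProductSpace.continuousLinearMapOfBilin aW)
    (LinearMap.ker_eq_bot.2 hb.1) (LinearMap.range_eq_top.2 hb.2)
  let G : K →L[𝕜] V := W.subtypeL ∘L (A.symm : W →L[𝕜] W) ∘L
    ContinuousLinearMap.adjoint (emb ∘L W.subtypeL)
  refine ⟨G, fun f => ?_, fun f v hv => ?_⟩
  · exact (A.symm (ContinuousLinearMap.adjoint (emb ∘L W.subtypeL) f)).2
  · have h1 : a (G f) v = ⟪A (A.symm (ContinuousLinearMap.adjoint (emb ∘L W.subtypeL) f)),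
        (⟨v, hv⟩ : W)⟫_𝕜 :=
      (InnerProductSpace.continuousLinearMapOfBilin_apply aW _ (⟨v, hv⟩ : W)).symm
    rw [h1, A.apply_symm_apply, ContinuousLinearMap.adjoint_inner_left]
    rfl

namespace IsSolutionOperator

variable {emb : V →L[𝕜] K} {a : V →L⋆[𝕜] V →L[𝕜] 𝕜} {W : Submodule 𝕜 V} {G : K →L[𝕜] V}

theorem unique (hG : IsSolutionOperator emb a W G) (ha : IsSymmCoercive a) {f : K} {w : V}
    (hw : w ∈ W) (h : ∀ v ∈ W, a w v = ⟪f, emb v⟫_𝕜) : w = G f := by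
  have hd := W.sub_mem hw (hG.mem f)
  refine sub_eq_zero.1 (ha.eq_zero ?_)
  rw [map_sub a, sub_apply, h _ hd, hG.eq _ _ hd, sub_self]

/-- Both sides equal $a(Gf,Gg)$, as `a` is Hermitian. -/
theorem isSymmetric (hG : IsSolutionOperator emb a W G) (ha : IsSymmCoercive a) :
    (emb ∘L G).IsSymmetric := by
  intro f g
  change ⟪emb (G f), g⟫_𝕜 = ⟪f, emb (G g)⟫_𝕜
  rw [← hG.eq f _ (hG.mem g), ← inner_conj_symm, ← hG.eq g _ (hG.mem f),
    ha.hermitian (G f) (G g), RCLike.conj_conj]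

/-- Testing with $Gf$ itself gives $\|Gf\|_a^2=(f,Gf)$, hence the square root of the eigenvalue in
the final estimate. -/
theorem energyNorm_le (hG : IsSolutionOperator emb a W G) {f : K} {B : ℝ} (hB : 0 ≤ B)
    (hf : ‖emb (G f)‖ ≤ B * ‖f‖) : energyNorm a (G f) ≤ Real.sqrt B * ‖f‖ := by
  rw [energyNorm, ← Real.sqrt_sq (norm_nonneg f), ← Real.sqrt_mul hB]
  refine Real.sqrt_le_sqrt ?_
  rw [hG.eq f _ (hG.mem f)]
  calc RCLike.re ⟪f, emb (G f)⟫_𝕜 ≤ ‖f‖ * ‖emb (G f)‖ := re_inner_le_norm _ _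
    _ ≤ ‖f‖ * (B * ‖f‖) := by gcongr
    _ = B * ‖f‖ ^ 2 := by ring

end IsSolutionOperator

end SolutionOperator

/-! ### The energy seminorm. -/

section Energy

variable {𝕜 : Type*} [RCLike 𝕜] {V : Type*} [NormedAddCommGroup V] [InnerProductSpace 𝕜 V]

/-- A coercive Hermitian form as a (pre-)inner product. -/
@[reducible]
def IsSymmCoercive.core {a : V →L⋆[𝕜] V →L[𝕜] 𝕜} (ha : IsSymmCoercive a) :
    PreInnerProductSpace.Core 𝕜 V where
  inner := fun u v => a u v
  conj_inner_symm := fun u v => by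
    rw [ha.hermitian u v, RCLike.conj_conj]
  re_inner_nonneg := ha.re_self_nonneg
  add_left := fun u v w => by simp
  smul_left := fun u v r => by simp

/-- The energy norm as a seminorm. -/
theorem IsSymmCoercive.exists_seminorm {a : V →L⋆[𝕜] V →L[𝕜] 𝕜} (ha : IsSymmCoercive a) :
    ∃ q : Seminorm 𝕜 V, ∀ v, q v = energyNorm a v :=
  have hc := InnerProductSpace.Core.toSeminormedSpaceCore ha.core
  ⟨Seminorm.of (energyNorm a) (@SeminormedSpace.Core.norm_triangle 𝕜 V _ _ (@InnerProductSpace.Core.toNorm 𝕜 V _ _ _ ha.core) _ hc)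
    (@SeminormedSpace.Core.norm_smul 𝕜 V _ _ (@InnerProductSpace.Core.toNorm 𝕜 V _ _ _ ha.core) _ hc), fun _ => rfl⟩

end Energy

/-! ### Chebyshev filters for the leading eigenvalues. -/

section Filter

open Polynomial

theorem lt_of_relGap_pos {lam : ℕ → ℝ} (hpos : ∀ j, 0 < lam j) {L : ℕ}
    (hgap : ∀ j < L, 0 < relGap lam j) {i j : ℕ} (hij : i < j) (hj : j ≤ L) :
    lam j < lam i := by
  have step : ∀ m < L, lam (m + 1) < lam m := by
    intro m hm
    have h := mul_pos (hgap m hm) (hpos (m + 1))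
    rw [relGap, div_mul_cancel₀ _ (hpos (m + 1)).ne'] at h
    linarith
  induction j, hij using Nat.le_induction with
  | base => exact step i hj
  | succ m hm ih => exact (step m hj).trans (ih (by omega))

/-- Chebyshev filter polynomials: they select the eigenvalue `lam j` among the first `L` ones and
are geometrically small on `[0, lam L]`. -/
theorem exists_filter_polynomial {lam : ℕ → ℝ} (hpos : ∀ j, 0 < lam j) (hanti : Antitone lam)
    {L : ℕ} {γ : ℝ} (hγ : 0 < γ) (hgap : ∀ j < L, γ ≤ relGap lam j) {j : ℕ} (hj : j < L) :
    ∃ C : ℝ, 0 ≤ C ∧ ∀ k : ℕ, ∃ p : ℝ[X], p.natDegree < k + L ∧ p.eval (lam j) = 1 ∧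
      (∀ i < L, i ≠ j → p.eval (lam i) = 0) ∧
      ∀ t, 0 ≤ t → t ≤ lam L → |p.eval t| ≤ C * (1 / (1 + 4 * γ)) ^ k := by
  classical
  set s := (Finset.range L).erase j with hs
  have hscard : s.card = L - 1 := by
    rw [hs, Finset.card_erase_of_mem (Finset.mem_range.2 hj), Finset.card_range]
  set R : ℝ[X] := ∏ i ∈ s, (X - Polynomial.C (lam i)) with hR
  have hReval : ∀ t, R.eval t = ∏ i ∈ s, (t - lam i) := fun t => by
    simp [hR, eval_prod]
  have hRdeg : R.natDegree = L - 1 := by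
    rw [hR, natDegree_prod_of_monic _ _ fun i _ => monic_X_sub_C _]
    simp [hscard]
  have hgap' : ∀ i < L, 0 < relGap lam i := fun i hi => hγ.trans_le (hgap i hi)
  have hRj : R.eval (lam j) ≠ 0 := by
    rw [hReval, Finset.prod_ne_zero_iff]
    intro i hi
    rw [hs, Finset.mem_erase, Finset.mem_range] at hi
    rcases lt_or_gt_of_ne hi.1 with h | h
    · exact sub_ne_zero.2 (lt_of_relGap_pos hpos hgap' h hj.le).ne
    · exact sub_ne_zero.2 (lt_of_relGap_pos hpos hgap' h hi.2.le).ne'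
  set D := ∏ i ∈ s, lam i with hD
  have hD0 : 0 ≤ D := Finset.prod_nonneg fun i _ => (hpos i).le
  have hRt : ∀ t, 0 ≤ t → t ≤ lam L → |R.eval t| ≤ D := by
    intro t ht htL
    rw [hReval, Finset.abs_prod]
    refine Finset.prod_le_prod (fun _ _ => abs_nonneg _) fun i hi => ?_
    rw [hs, Finset.mem_erase, Finset.mem_range] at hi
    have := hanti hi.2.le
    rw [abs_le]
    constructor <;> linarith
  -- `D` bounds `R` on $[0,\lambda_L]$, where $|t-\lambda_i|\le\lambda_i$; the 2 undoes the factor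
  -- 1/2 in the Chebyshev lower bound.
  refine ⟨2 * D / |R.eval (lam j)|, by positivity, fun k => ?_⟩
  -- The affine map takes $[0,\lambda_L]$ onto $[-1,1]$ and $\lambda_j$ to a point $\ge1+2\gamma$.
  set T : ℝ[X] := (Chebyshev.T ℝ k).comp (Polynomial.C (2 / lam L) * X - Polynomial.C 1) with hT
  have hTeval : ∀ t, T.eval t = (Chebyshev.T ℝ k).eval (2 / lam L * t - 1) := fun t => by
    simp [hT, eval_comp]
  have hTdeg : T.natDegree ≤ k := by
    refine natDegree_comp_le.trans ?_
    have h1 : (Polynomial.C (2 / lam L) * X - Polynomial.C (1 : ℝ)).natDegree ≤ 1 := by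
      compute_degree
    have h2 : (Chebyshev.T ℝ (k : ℤ)).natDegree = k := by
      rw [Chebyshev.natDegree_T]; simp
    rw [h2]
    nlinarith
  have hTj : (1 + 4 * γ) ^ k / 2 ≤ T.eval (lam j) := by
    rw [hTeval]
    refine half_pow_le_eval_chebyshev hγ.le ?_ k
    -- Only the last gap, between $\lambda_{L-1}$ and $\lambda_L$, sets the rate; the other gaps
    -- only separate the roots of `R` from $\lambda_j$.
    obtain ⟨l, rfl⟩ : ∃ l, L = l + 1 := ⟨L - 1, by omega⟩
    have h1 := hgap l (by omega)
    have hp := hpos (l + 1)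
    rw [relGap, le_div_iff₀ hp] at h1
    have h2 : lam l ≤ lam j := hanti (by omega)
    have h3 : 1 + γ ≤ lam j / lam (l + 1) := by
      rw [le_div_iff₀ hp]; linarith
    have h4 : 2 / lam (l + 1) * lam j = 2 * (lam j / lam (l + 1)) := by ring
    rw [h4]; linarith
  have hpw : 0 < (1 + 4 * γ) ^ k := by positivity
  have hTj0 : 0 < T.eval (lam j) := by linarith
  have hTt : ∀ t, 0 ≤ t → t ≤ lam L → |T.eval t| ≤ 1 := by
    intro t ht htL
    rw [hTeval]
    refine Chebyshev.abs_eval_T_real_le_one _ ?_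
    have h1 : 2 / lam L * t = 2 * (t / lam L) := by ring
    have h2 : t / lam L ≤ 1 := (div_le_one (hpos L)).2 htL
    have h3 : 0 ≤ t / lam L := div_nonneg ht (hpos L).le
    rw [h1, abs_le]
    constructor <;> linarith
  refine ⟨Polynomial.C ((T.eval (lam j) * R.eval (lam j))⁻¹) * (T * R), ?_, ?_, ?_, ?_⟩
  · refine lt_of_le_of_lt (natDegree_C_mul_le _ _) (lt_of_le_of_lt natDegree_mul_le ?_)
    omega
  · rw [eval_mul, eval_C, eval_mul]
    exact inv_mul_cancel₀ (mul_ne_zero hTj0.ne' hRj)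
  · intro i hi hij
    have : R.eval (lam i) = 0 := by
      rw [hReval]
      exact Finset.prod_eq_zero (i := i) (by simp [hs, hi, hij]) (sub_self _)
    simp [this]
  · intro t ht htL
    have h1 : |T.eval t| * |R.eval t| ≤ 1 * D :=
      mul_le_mul (hTt t ht htL) (hRt t ht htL) (abs_nonneg _) zero_le_one
    have h2 : (T.eval (lam j))⁻¹ ≤ 2 * (1 / (1 + 4 * γ)) ^ k := by
      rw [one_div, inv_pow, ← div_eq_mul_inv, ← inv_div]
      exact inv_anti₀ (by positivity) hTj
    have h3 : 0 < |R.eval (lam j)| := abs_pos.2 hRj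
    rw [eval_mul, eval_C, eval_mul, abs_mul, abs_mul, abs_inv, abs_mul, abs_of_pos hTj0, mul_inv]
    calc (T.eval (lam j))⁻¹ * |R.eval (lam j)|⁻¹ * (|T.eval t| * |R.eval t|)
        ≤ (2 * (1 / (1 + 4 * γ)) ^ k) * |R.eval (lam j)|⁻¹ * (1 * D) := by gcongr
      _ = 2 * D / |R.eval (lam j)| * (1 / (1 + 4 * γ)) ^ k := by ring

end Filter

/-! ### Spectral truncation and Krylov approximation in one subdomain. -/

section Local

open Polynomial

variable {𝕜 : Type*} [RCLike 𝕜] {K : Type*} [NormedAddCommGroup K] [InnerProductSpace 𝕜 K]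
variable {V : Type*} [NormedAddCommGroup V] [InnerProductSpace 𝕜 V]

/-- `(lam j, φ j)` enumerates the eigenpairs of `G ∘ emb` on `W`, in non-increasing order, with
`emb ∘ φ` orthonormal. -/
structure IsEigenEnumeration (emb : V →L[𝕜] K) (W : Submodule 𝕜 V) (G : K →L[𝕜] V)
    (lam : ℕ → ℝ) (φ : ℕ → V) : Prop where
  mem : ∀ j, φ j ∈ W
  eigen : ∀ j, G (emb (φ j)) = (lam j : 𝕜) • φ j
  orthonormal : Orthonormal 𝕜 fun j => emb (φ j)
  antitone : Antitone lam
  all_eigen : ∀ (μ : ℝ), ∀ v ∈ W, G (emb v) = (μ : 𝕜) • v →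
    v ∈ Submodule.span 𝕜 (φ '' {j | lam j = μ})

/-- The expansion of `x` in the first `L` members of the orthonormal family `e`. -/
def headProj (e : ℕ → K) (L : ℕ) (x : K) : K := ∑ j ∈ Finset.range L, ⟪e j, x⟫_𝕜 • e j

/-- The orthogonal complement of the first `L` members of `e`. -/
def tailSpace (𝕜 : Type*) [RCLike 𝕜] {K : Type*} [NormedAddCommGroup K] [InnerProductSpace 𝕜 K]
    (e : ℕ → K) (L : ℕ) : Submodule 𝕜 K := (Submodule.span 𝕜 (e '' Set.Iio L))ᗮ

theorem mem_tailSpace {e : ℕ → K} {L : ℕ} {x : K} :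
    x ∈ tailSpace 𝕜 e L ↔ ∀ j < L, ⟪e j, x⟫_𝕜 = 0 := by
  rw [tailSpace, Submodule.mem_orthogonal]
  constructor
  · intro h j hj
    exact h _ (Submodule.subset_span ⟨j, hj, rfl⟩)
  · intro h u hu
    induction hu using Submodule.span_induction with
    | mem u hu => obtain ⟨j, hj, rfl⟩ := hu; exact h j hj
    | zero => exact inner_zero_left _
    | add u v _ _ hu hv => rw [inner_add_left, hu, hv, add_zero]
    | smul c u _ hu => rw [inner_smul_left, hu, mul_zero]

theorem sub_headProj_mem_tailSpace {e : ℕ → K} (he : Orthonormal 𝕜 e) (L : ℕ) (x : K) :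
    x - headProj (𝕜 := 𝕜) e L x ∈ tailSpace 𝕜 e L := by
  rw [mem_tailSpace]
  intro j hj
  rw [inner_sub_right, headProj, he.inner_right_sum _ (Finset.mem_range.2 hj), sub_self]

theorem norm_sub_headProj_le {e : ℕ → K} (he : Orthonormal 𝕜 e) (L : ℕ) (x : K) :
    ‖x - headProj (𝕜 := 𝕜) e L x‖ ≤ ‖x‖ := by
  set y := x - headProj (𝕜 := 𝕜) e L x with hy
  have hy' := sub_headProj_mem_tailSpace he L x
  rw [← hy, mem_tailSpace] at hy'
  have h0 : ⟪headProj (𝕜 := 𝕜) e L x, y⟫_𝕜 = 0 := by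
    rw [headProj, sum_inner]
    refine Finset.sum_eq_zero fun j hj => ?_
    rw [inner_smul_left, hy' j (Finset.mem_range.1 hj), mul_zero]
  have h1 : ⟪x, y⟫_𝕜 = ⟪y, y⟫_𝕜 := by
    conv_rhs => rw [hy, inner_sub_left, ← hy, h0, sub_zero]
  have h2 : ‖y‖ ^ 2 ≤ ‖x‖ * ‖y‖ := by
    rw [@norm_sq_eq_re_inner 𝕜, ← h1]
    exact re_inner_le_norm x y
  rcases (norm_nonneg y).eq_or_lt with h | h
  · rw [← h]; exact norm_nonneg x
  · nlinarith

variable {emb : V →L[𝕜] K} {a : V →L⋆[𝕜] V →L[𝕜] 𝕜} {W : Submodule 𝕜 V} {G : K →L[𝕜] V}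
variable {lam : ℕ → ℝ} {φ : ℕ → V}

namespace IsEigenEnumeration

/-- Testing the eigenvalue equation with $\phi_j$ gives
$\lambda_j\,a(\phi_j,\phi_j)=\|\phi_j\|_{L^2}^2=1$. -/
theorem lam_pos (hφ : IsEigenEnumeration emb W G lam φ) (hG : IsSolutionOperator emb a W G)
    (ha : IsSymmCoercive a) (j : ℕ) : 0 < lam j := by
  have h1 := hG.eq (emb (φ j)) (φ j) (hφ.mem j)
  rw [hφ.eigen j, inner_self_eq_norm_sq_to_K, hφ.orthonormal.1 j] at h1
  have h2 : lam j * RCLike.re (a (φ j) (φ j)) = 1 := by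
    have h3 := congrArg RCLike.re h1
    simpa [RCLike.smul_re] using h3
  have h4 := ha.re_self_nonneg (φ j)
  by_contra hneg
  nlinarith

theorem tailSpace_invariant (hφ : IsEigenEnumeration emb W G lam φ)
    (hG : IsSolutionOperator emb a W G) (ha : IsSymmCoercive a) (L : ℕ) :
    ∀ x ∈ tailSpace 𝕜 (fun j => emb (φ j)) L, (emb ∘L G) x ∈ tailSpace 𝕜 (fun j => emb (φ j)) L := by
  intro x hx
  rw [mem_tailSpace] at hx ⊢
  intro j hj
  have h := hG.isSymmetric ha (emb (φ j)) x
  change ⟪emb (G (emb (φ j))), x⟫_𝕜 = ⟪emb (φ j), emb (G x)⟫_𝕜 at h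
  change ⟪emb (φ j), emb (G x)⟫_𝕜 = 0
  rw [← h, hφ.eigen j, map_smul, inner_smul_left, hx j hj, mul_zero]

/-- On the complement of the first `L` eigenfunctions, polynomials of the inverse operator are
bounded by their maximum on `[0, lam L]`. -/
theorem norm_aeval_le [CompleteSpace K] (hφ : IsEigenEnumeration emb W G lam φ)
    (hG : IsSolutionOperator emb a W G) (ha : IsSymmCoercive a) (hemb : IsCompactOperator emb)
    {L : ℕ} (p : ℝ[X]) {B : ℝ} (hB : ∀ t, 0 ≤ t → t ≤ lam L → |p.eval t| ≤ B) {x : K}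
    (hx : x ∈ tailSpace 𝕜 (fun j => emb (φ j)) L) :
    ‖aeval ((emb ∘L G : K →L[𝕜] K) : Module.End 𝕜 K) (p.map (algebraMap ℝ 𝕜)) x‖ ≤ B * ‖x‖ := by
  refine norm_aeval_le_of_mem_invariant (hemb.comp_clm G) (hG.isSymmetric ha)
    (Submodule.isClosed_orthogonal _) (hφ.tailSpace_invariant hG ha L) p ?_ hx
  intro μ x hx hx0 hev
  change emb (G x) = (μ : 𝕜) • x at hev
  have hn : 0 < ‖x‖ ^ 2 := by have := norm_pos_iff.2 hx0; positivity
  have hμ0 : 0 ≤ μ := by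
    have h1 := hG.eq x (G x) (hG.mem x)
    rw [hev, inner_smul_right, inner_self_eq_norm_sq_to_K] at h1
    have h2 := congrArg RCLike.re h1
    have h3 := ha.re_self_nonneg (G x)
    rw [h2] at h3
    have h4 : 0 ≤ μ * ‖x‖ ^ 2 := by
      have h5 : ((μ : 𝕜) * (‖x‖ : 𝕜) ^ 2) = ((μ * ‖x‖ ^ 2 : ℝ) : 𝕜) := by push_cast; rfl
      rwa [h5, RCLike.ofReal_re] at h3
    by_contra hneg
    nlinarith
  -- If $\mu>\lambda_L$, then $x$ lifts to the eigenfunction $\mu^{-1}Gx$ in `W`. Completeness of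
  -- the enumeration puts it in the span of $\phi_j$ with $j<L$, so $x$ is orthogonal to itself.
  refine hB μ hμ0 (not_lt.1 fun hlt => hx0 ?_)
  have hμ := (hφ.lam_pos hG ha L).trans hlt
  have hμ𝕜 : (μ : 𝕜) ≠ 0 := by exact_mod_cast hμ.ne'
  set w := (μ : 𝕜)⁻¹ • G x with hw
  have hembw : emb w = x := by
    rw [hw, map_smul, hev, smul_smul, inv_mul_cancel₀ hμ𝕜, one_smul]
  have hspan := hφ.all_eigen μ w (W.smul_mem _ (hG.mem x)) (by
    rw [hembw, hw, smul_smul, mul_inv_cancel₀ hμ𝕜, one_smul])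
  have hx' : x ∈ Submodule.span 𝕜 ((fun j => emb (φ j)) '' Set.Iio L) := by
    rw [← hembw]
    have h1 := Submodule.mem_map_of_mem (f := (emb : V →ₗ[𝕜] K)) hspan
    rw [Submodule.map_span, ← Set.image_comp] at h1
    refine Submodule.span_mono (Set.image_mono ?_) h1
    intro j hj
    by_contra hjL
    have hle : lam j ≤ lam L := hφ.antitone (not_lt.1 hjL)
    have hj' : lam j = μ := hj
    linarith
  exact inner_self_eq_zero.1 (hx x hx')

/-- Spectral truncation error of a local solution in the energy norm. -/
theorem energyNorm_sub_sum_le [CompleteSpace K] (hφ : IsEigenEnumeration emb W G lam φ)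
    (hG : IsSolutionOperator emb a W G) (ha : IsSymmCoercive a) (hemb : IsCompactOperator emb)
    (L : ℕ) (g : K) :
    energyNorm a (G g - ∑ j ∈ Finset.range L, ⟪emb (φ j), emb (G g)⟫_𝕜 • φ j)
      ≤ Real.sqrt (lam L) * ‖g‖ := by
  set e : ℕ → K := fun j => emb (φ j) with he
  -- `G` commutes with spectral truncation, so the remainder is `G` applied to the tail of `g`.
  have h1 : G g - ∑ j ∈ Finset.range L, ⟪emb (φ j), emb (G g)⟫_𝕜 • φ j
      = G (g - headProj (𝕜 := 𝕜) e L g) := by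
    rw [map_sub, headProj, map_sum]
    congr 1
    refine Finset.sum_congr rfl fun j _ => ?_
    have h := hG.isSymmetric ha (emb (φ j)) g
    change ⟪emb (G (emb (φ j))), g⟫_𝕜 = ⟪emb (φ j), emb (G g)⟫_𝕜 at h
    rw [← h, hφ.eigen j, map_smul, map_smul, inner_smul_left, RCLike.conj_ofReal, he,
      hφ.eigen j, smul_smul, mul_comm]
  have hpos := (hφ.lam_pos hG ha L).le
  rw [h1]
  refine (hG.energyNorm_le hpos ?_).trans
    (mul_le_mul_of_nonneg_left (norm_sub_headProj_le hφ.orthonormal L g) (Real.sqrt_nonneg _))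
  have h2 := hφ.norm_aeval_le hG ha hemb X (B := lam L) (L := L)
    (fun t h0 h1 => by rw [eval_X, abs_of_nonneg h0]; exact h1)
    (sub_headProj_mem_tailSpace hφ.orthonormal L g)
  rw [map_X, aeval_X] at h2
  exact h2

end IsEigenEnumeration

/-- Polynomials of the inverse operator applied to the starting vector lie in the Krylov space. -/
theorem apply_aeval_mem_span_krylov {ψ : ℕ → V}
    (hK : ∀ n, ∃ d : 𝕜, G (emb (ψ n)) = d • ψ (n + 1)) (P : 𝕜[X]) {n : ℕ} (hP : P.natDegree < n) :
    G (aeval ((emb ∘L G : K →L[𝕜] K) : Module.End 𝕜 K) P (emb (ψ 0)))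
      ∈ Submodule.span 𝕜 (ψ '' Set.Iic n) := by
  have hpow : ∀ k, ∃ d : 𝕜,
      G ((((emb ∘L G : K →L[𝕜] K) : Module.End 𝕜 K) ^ k) (emb (ψ 0))) = d • ψ (k + 1) := by
    intro k
    induction k with
    | zero => exact hK 0
    | succ k ih =>
      obtain ⟨d, hd⟩ := ih
      obtain ⟨d', hd'⟩ := hK (k + 1)
      refine ⟨d * d', ?_⟩
      rw [pow_succ', Module.End.mul_apply]
      change G (emb (G _)) = _
      rw [hd, map_smul, map_smul, hd', smul_smul]
  rw [aeval_eq_sum_range, LinearMap.sum_apply, map_sum]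
  refine Submodule.sum_mem _ fun k hk => ?_
  obtain ⟨d, hd⟩ := hpow k
  rw [LinearMap.smul_apply, map_smul, hd]
  refine Submodule.smul_mem _ _ (Submodule.smul_mem _ _ (Submodule.subset_span ⟨k + 1, ?_, rfl⟩))
  have := Finset.mem_range.1 hk
  exact Set.mem_Iic.2 (by omega)

/-- Geometric convergence of the Krylov spaces to the `j`-th eigenfunction. -/
theorem IsEigenEnumeration.exists_krylov_approx [CompleteSpace K]
    (hφ : IsEigenEnumeration emb W G lam φ)
    (hG : IsSolutionOperator emb a W G) (ha : IsSymmCoercive a) (hemb : IsCompactOperator emb)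
    {ψ : ℕ → V} (hK : ∀ n, ∃ d : 𝕜, G (emb (ψ n)) = d • ψ (n + 1)) {L : ℕ} {γ : ℝ} (hγ : 0 ≤ γ)
    (hgap : ∀ j < L, γ ≤ relGap lam j) {j : ℕ} (hj : j < L)
    (hangle : ⟪emb (φ j), emb (ψ 0)⟫_𝕜 ≠ 0) :
    ∃ C : ℝ, 0 ≤ C ∧ ∀ n, ∃ p ∈ Submodule.span 𝕜 (ψ '' Set.Iic n),
      energyNorm a (φ j - p) ≤ C * (1 / (1 + 4 * γ)) ^ n := by
  have hpos := hφ.lam_pos hG ha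
  obtain ⟨q, hq⟩ := ha.exists_seminorm
  rcases hγ.eq_or_lt with rfl | hγ
  -- With zero gap the claimed rate is 1, and the zero vector suffices.
  · exact ⟨energyNorm a (φ j), Real.sqrt_nonneg _, fun n => ⟨0, Submodule.zero_mem _, by simp⟩⟩
  obtain ⟨C₀, hC₀, hfil⟩ := exists_filter_polynomial hpos hφ.antitone hγ hgap hj
  set e : ℕ → K := fun j => emb (φ j) with he
  set c := ⟪emb (φ j), emb (ψ 0)⟫_𝕜 with hc
  set y := emb (ψ 0) - headProj (𝕜 := 𝕜) e L (emb (ψ 0)) with hy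
  set S : K →L[𝕜] K := emb ∘L G with hS
  set r := 1 / (1 + 4 * γ) with hr
  have hr0 : 0 < r := by positivity
  have hr1 : r ≠ 0 := hr0.ne'
  set C₁ := ‖(c * (lam j : 𝕜))⁻¹‖ * (Real.sqrt ‖S‖ * (C₀ * ‖y‖)) with hC₁
  have hC₁0 : 0 ≤ C₁ := by positivity
  set C₂ := max (energyNorm a (φ j)) C₁ with hC₂
  have hC₂0 : 0 ≤ C₂ := hC₁0.trans (le_max_right _ _)
  -- The filter spends `L` degrees before any decay begins, which the factor $r^{-L}$ absorbs. The
  -- maximum in `C₂` covers `n < L`, where zero is used.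
  refine ⟨C₂ * (r ^ L)⁻¹, by positivity, fun n => ?_⟩
  rcases lt_or_ge n L with hn | hn
  · refine ⟨0, Submodule.zero_mem _, ?_⟩
    have hrle : r ≤ 1 := by
      rw [hr, div_le_one (by positivity)]; linarith
    have h1 : 1 ≤ (r ^ L)⁻¹ * r ^ n := by
      rw [inv_mul_eq_div, one_le_div (by positivity)]
      exact pow_le_pow_of_le_one hr0.le hrle hn.le
    rw [sub_zero, mul_assoc]
    calc energyNorm a (φ j) ≤ C₂ := le_max_left _ _
      _ = C₂ * 1 := (mul_one _).symm
      _ ≤ _ := mul_le_mul_of_nonneg_left h1 hC₂0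
  obtain ⟨k, rfl⟩ : ∃ k, n = k + L := ⟨n - L, by omega⟩
  obtain ⟨p, hpdeg, hpj, hpi, hpt⟩ := hfil k
  set P : 𝕜[X] := p.map (algebraMap ℝ 𝕜) with hP
  set h := aeval (S : Module.End 𝕜 K) P y with hh
  have hPeval : ∀ t : ℝ, P.eval (t : 𝕜) = ((p.eval t : ℝ) : 𝕜) := by
    intro t
    rw [hP, eval_map_algebraMap]
    exact aeval_algebraMap_apply 𝕜 t p
  have haev : ∀ i, aeval (S : Module.End 𝕜 K) P (e i) = ((p.eval (lam i) : ℝ) : 𝕜) • e i := by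
    intro i
    rw [← hPeval]
    refine Module.End.aeval_apply_of_hasEigenvector
      ⟨Module.End.mem_eigenspace_iff.2 ?_, hφ.orthonormal.ne_zero i⟩
    change emb (G (emb (φ i))) = _
    rw [hφ.eigen, map_smul]
  have hhead : aeval (S : Module.End 𝕜 K) P (headProj (𝕜 := 𝕜) e L (emb (ψ 0))) = c • e j := by
    rw [headProj, map_sum, Finset.sum_eq_single_of_mem j (Finset.mem_range.2 hj)]
    · rw [map_smul, haev, hpj]; simp [hc, he]
    · intro i hi hij
      rw [map_smul, haev, hpi i (Finset.mem_range.1 hi) hij]; simp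
  -- The filter leaves only the $j$-th term of the head; dividing by $c\lambda_j$ isolates $\phi_j$
  -- up to the small tail $Gh$.
  have hv : G (aeval (S : Module.End 𝕜 K) P (emb (ψ 0))) = (c * (lam j : 𝕜)) • φ j + G h := by
    have h1 : emb (ψ 0) = headProj (𝕜 := 𝕜) e L (emb (ψ 0)) + y := by rw [hy]; abel
    rw [h1, map_add, hhead, map_add, map_smul, he, hφ.eigen, smul_smul]
  have hcl : c * (lam j : 𝕜) ≠ 0 := mul_ne_zero hangle (by exact_mod_cast (hpos j).ne')
  refine ⟨(c * (lam j : 𝕜))⁻¹ • G (aeval (S : Module.End 𝕜 K) P (emb (ψ 0))),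
    Submodule.smul_mem _ _ (apply_aeval_mem_span_krylov hK P
      (lt_of_le_of_lt natDegree_map_le hpdeg)), ?_⟩
  rw [hv, smul_add, smul_smul, inv_mul_cancel₀ hcl, one_smul, sub_add_cancel_left, ← hq, map_neg_eq_map,
    map_smul_eq_mul, hq]
  have hnorm : ‖h‖ ≤ C₀ * r ^ k * ‖y‖ :=
    hφ.norm_aeval_le hG ha hemb p hpt (sub_headProj_mem_tailSpace hφ.orthonormal L _)
  have hen : energyNorm a (G h) ≤ Real.sqrt ‖S‖ * (C₀ * r ^ k * ‖y‖) :=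
    (hG.energyNorm_le (norm_nonneg S) (S.le_opNorm h)).trans
      (mul_le_mul_of_nonneg_left hnorm (Real.sqrt_nonneg _))
  calc ‖(c * (lam j : 𝕜))⁻¹‖ * energyNorm a (G h)
      ≤ ‖(c * (lam j : 𝕜))⁻¹‖ * (Real.sqrt ‖S‖ * (C₀ * r ^ k * ‖y‖)) := by gcongr
    _ = C₁ * r ^ k := by rw [hC₁]; ring
    _ ≤ C₂ * r ^ k := by gcongr; exact le_max_right _ _
    _ = C₂ * (r ^ L)⁻¹ * r ^ (k + L) := by
      rw [pow_add]; field_simp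

end Local

/-! ### Assembly over the subdomains. -/

section Main

variable {𝕜 : Type*} [RCLike 𝕜] {d m : ℕ} {Ω : Set (EuclideanSpace ℝ (Fin d))}
variable {V : Type*} [NormedAddCommGroup V] [InnerProductSpace 𝕜 V]
variable {emb : V →L[𝕜] L2 𝕜 m Ω} {a : V →L⋆[𝕜] V →L[𝕜] 𝕜}
variable {ω : Set (EuclideanSpace ℝ (Fin d))}

/-- $V(\omega)$ is the kernel of a continuous map: the embedding followed by restriction to the
complement of $\omega$. -/
theorem isClosed_localSpace (emb : V →L[𝕜] L2 𝕜 m Ω) (hω : MeasurableSet ω) :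
    IsClosed (localSpace emb ω : Set V) := by
  let R : V →L[𝕜] Lp (EuclideanSpace 𝕜 (Fin m)) 2 ((volume.restrict Ω).restrict ωᶜ) :=
    (LpToLpRestrictCLM _ _ 𝕜 (volume.restrict Ω) 2 ωᶜ) ∘L emb
  have h : (localSpace emb ω : Set V) = R ⁻¹' {0} := by
    ext v
    change (∀ᵐ x ∂(volume.restrict Ω), x ∈ ωᶜ → emb v x = 0) ↔
      LpToLpRestrictCLM _ _ 𝕜 (volume.restrict Ω) 2 ωᶜ (emb v) = 0
    rw [← ae_restrict_iff' hω.compl, Lp.eq_zero_iff_ae_eq_zero]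
    have h1 := LpToLpRestrictCLM_coeFn 𝕜 ωᶜ (emb v)
    exact ⟨fun h2 => h1.trans h2, fun h2 => h1.symm.trans h2⟩
  rw [h]
  exact isClosed_singleton.preimage R.continuous

theorem IsLocalEigenSystem.isEigenEnumeration {G : L2 𝕜 m Ω →L[𝕜] V}
    {lam : ℕ → ℝ} {φ : ℕ → V} (h : IsLocalEigenSystem emb a ω lam φ) (ha : IsSymmCoercive a)
    (hG : IsSolutionOperator emb a (localSpace emb ω) G) :
    IsEigenEnumeration emb (localSpace emb ω) G lam φ where
  mem j := (h.eigen j).1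
  eigen j := (hG.unique ha (h.eigen j).2.1 (h.eigen j).2.2).symm
  orthonormal := h.orthonormal
  antitone := h.antitone
  all_eigen μ v hv hev := h.all_eigen μ v
    ⟨hv, Submodule.smul_mem _ _ hv, fun z hz => by rw [← hev]; exact hG.eq _ z hz⟩

/-- The saddle point equation says $\psi^{n+1}=-\bar\mu\,G\psi^n$, conjugated because `a` is
conjugate-linear in its first slot. The normalization rules out $\mu=0$. -/
theorem IsKrylovIteration.exists_smul {G : L2 𝕜 m Ω →L[𝕜] V} {ψ : ℕ → V}
    (h : IsKrylovIteration emb a ω ψ) (ha : IsSymmCoercive a)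
    (hG : IsSolutionOperator emb a (localSpace emb ω) G) (n : ℕ) :
    ∃ d : 𝕜, G (emb (ψ n)) = d • ψ (n + 1) := by
  obtain ⟨μ, hμ⟩ := h.saddle n
  have h1 : ψ (n + 1) = (-conj μ) • G (emb (ψ n)) := by
    rw [← map_smul]
    refine hG.unique ha (h.mem (n + 1)) fun v hv => ?_
    rw [inner_smul_left, map_neg, RCLike.conj_conj, neg_mul]
    exact eq_neg_of_add_eq_zero_left (hμ v hv)
  have h2 : -conj μ ≠ 0 := by
    intro h0
    have h3 := h.normalized n
    rw [h1, h0, zero_smul, map_zero, inner_zero_right] at h3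
    exact zero_ne_one h3
  exact ⟨(-conj μ)⁻¹, by rw [h1, smul_smul, inv_mul_cancel₀ h2, one_smul]⟩

/-- Approximation of a local solution in the local Krylov space. -/
theorem exists_local_approx [CompleteSpace V] (hcomp : IsCompactOperator emb)
    (ha : IsSymmCoercive a) (hω : MeasurableSet ω) {lam : ℕ → ℝ} {φ : ℕ → V}
    (hφ : IsLocalEigenSystem emb a ω lam φ) {ψ : ℕ → V} (hψ : IsKrylovIteration emb a ω ψ)
    {L : ℕ} (hangle : ∀ j < L, inner 𝕜 (emb (φ j)) (emb (ψ 0)) ≠ 0) {γ : ℝ} (hγ : 0 ≤ γ)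
    (hgap : ∀ j < L, γ ≤ relGap lam j) :
    ∃ C : ℝ, 0 ≤ C ∧ ∀ (n : ℕ) (g : L2 𝕜 m Ω) (w : V),
      IsVarSolution emb a (localSpace emb ω) g w →
      ∃ v ∈ Submodule.span 𝕜 (ψ '' Set.Iic n),
        energyNorm a (w - v) ≤ Real.sqrt (lam L) * ‖g‖ + C * (1 / (1 + 4 * γ)) ^ n * ‖emb w‖ := by
  obtain ⟨G, hG⟩ := exists_isSolutionOperator emb ha (isClosed_localSpace emb hω)
  have hE := hφ.isEigenEnumeration ha hG
  obtain ⟨q, hq⟩ := ha.exists_seminorm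
  have hex : ∀ j : Fin L, ∃ C : ℝ, 0 ≤ C ∧ ∀ n, ∃ p ∈ Submodule.span 𝕜 (ψ '' Set.Iic n),
      energyNorm a (φ j - p) ≤ C * (1 / (1 + 4 * γ)) ^ n := fun j =>
    hE.exists_krylov_approx hG ha hcomp (hψ.exists_smul ha hG) hγ hgap j.2 (hangle j j.2)
  choose C hC p hpmem hp using hex
  refine ⟨∑ j, C j, Finset.sum_nonneg fun j _ => hC j, fun n g w hw => ?_⟩
  obtain rfl := hG.unique ha hw.1 hw.2
  set c : ℕ → 𝕜 := fun j => ⟪emb (φ j), emb (G g)⟫_𝕜 with hc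
  have hcle : ∀ j, ‖c j‖ ≤ ‖emb (G g)‖ := fun j => by
    refine (norm_inner_le_norm _ _).trans ?_
    rw [hφ.orthonormal.1 j, one_mul]
  refine ⟨∑ j : Fin L, c j • p j n, Submodule.sum_mem _ fun j _ =>
    Submodule.smul_mem _ _ (hpmem j n), ?_⟩
  -- Spectral remainder plus the Krylov errors of the individual eigenfunctions.
  have h1 : G g - ∑ j : Fin L, c j • p j n
      = (G g - ∑ j ∈ Finset.range L, c j • φ j) + ∑ j : Fin L, c j • (φ j - p j n) := by
    simp only [smul_sub, Finset.sum_sub_distrib]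
    rw [Finset.sum_range (fun j => c j • φ j)]
    abel
  have h2 := hE.energyNorm_sub_sum_le hG ha hcomp L g
  rw [h1, ← hq]
  refine (map_add_le_add q _ _).trans (add_le_add ((hq _).trans_le h2) ?_)
  refine (Finset.le_sum_of_subadditive q (map_zero q).le (map_add_le_add q) _ _).trans ?_
  rw [Finset.sum_mul, Finset.sum_mul]
  refine Finset.sum_le_sum fun j _ => ?_
  rw [map_smul_eq_mul, hq, mul_comm]
  exact mul_le_mul (hp j n) (hcle j) (norm_nonneg _) (mul_nonneg (hC j) (by positivity))

/-- Quasi-optimality (Céa) of the Galerkin solution in the energy norm. -/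
theorem energyNorm_sub_galerkin_le (ha : IsSymmCoercive a) {X : Submodule 𝕜 V} {f : L2 𝕜 m Ω}
    {u uX : V} (hu : IsVarSolution emb a ⊤ f u) (huX : IsVarSolution emb a X f uX) {v : V}
    (hv : v ∈ X) : energyNorm a (u - uX) ≤ energyNorm a (u - v) := by
  have horth : ∀ z ∈ X, a (u - uX) z = 0 := fun z hz => by
    rw [map_sub a, sub_apply, hu.2 z trivial, huX.2 z hz, sub_self]
  have hz := X.sub_mem huX.1 hv
  have h1 : u - v = (u - uX) + (uX - v) := by abel
  -- Galerkin orthogonality kills both cross terms, leaving Pythagoras.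
  have h2 : a (uX - v) (u - uX) = 0 := by
    rw [ha.hermitian (u - uX) (uX - v), horth _ hz, map_zero]
  have h3 : a (u - v) (u - v) = a (u - uX) (u - uX) + a (uX - v) (uX - v) := by
    rw [h1, map_add a, add_apply, map_add, map_add, horth _ hz, h2]
    ring
  refine Real.sqrt_le_sqrt ?_
  rw [h3, map_add]
  linarith [ha.re_self_nonneg (uX - v)]

theorem span_le_krylovSpace {Nc : ℕ} (ψ : Fin Nc → ℕ → V) (n : ℕ) (i : Fin Nc) :
    Submodule.span 𝕜 (ψ i '' Set.Iic n) ≤ krylovSpace 𝕜 ψ n :=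
  le_iSup (fun i => Submodule.span 𝕜 (ψ i '' Set.Iic n)) i

theorem IsPartitionOfUnity.le_one {Nc : ℕ} {ω : Fin Nc → Set (EuclideanSpace ℝ (Fin d))}
    {χ : Fin Nc → EuclideanSpace ℝ (Fin d) → ℝ} (hχ : IsPartitionOfUnity Ω ω χ) (i : Fin Nc)
    {x : EuclideanSpace ℝ (Fin d)} (hx : x ∈ Ω) : χ i x ≤ 1 := by
  rw [← hχ.sum_eq_one x hx]
  exact Finset.single_le_sum (fun j _ => hχ.nonneg j x) (Finset.mem_univ i)

theorem IsPartitionOfUnity.norm_le {Nc : ℕ} {ω : Fin Nc → Set (EuclideanSpace ℝ (Fin d))}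
    {χ : Fin Nc → EuclideanSpace ℝ (Fin d) → ℝ} (hχ : IsPartitionOfUnity Ω ω χ)
    (hΩ : MeasurableSet Ω) (i : Fin Nc) {u w : L2 𝕜 m Ω}
    (hw : ∀ᵐ x ∂(volume.restrict Ω), w x = (χ i x : 𝕜) • u x) : ‖w‖ ≤ ‖u‖ := by
  refine Lp.norm_le_norm_of_ae_le ?_
  filter_upwards [hw, ae_restrict_mem hΩ] with x hx hxΩ
  rw [hx, norm_smul, RCLike.norm_ofReal, abs_of_nonneg (hχ.nonneg i x)]
  exact mul_le_of_le_one_left (norm_nonneg _) (hχ.le_one i hxΩ)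

theorem IsPartitionOfUnity.sum_eq {Nc : ℕ} {ω : Fin Nc → Set (EuclideanSpace ℝ (Fin d))}
    {χ : Fin Nc → EuclideanSpace ℝ (Fin d) → ℝ} (hχ : IsPartitionOfUnity Ω ω χ)
    (hΩ : MeasurableSet Ω) {u : L2 𝕜 m Ω} {w : Fin Nc → L2 𝕜 m Ω}
    (hw : ∀ i, ∀ᵐ x ∂(volume.restrict Ω), w i x = (χ i x : 𝕜) • u x) : ∑ i, w i = u := by
  refine Lp.ext ?_
  filter_upwards [ae_all_iff.2 hw, ae_restrict_mem hΩ,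
    Lp.coeFn_finsetSum Finset.univ w] with x hx hxΩ hsum
  rw [hsum, Finset.sum_apply, Finset.sum_congr rfl fun i _ => hx i, ← Finset.sum_smul,
    ← RCLike.ofReal_sum, hχ.sum_eq_one x hxΩ, RCLike.ofReal_one, one_smul]

theorem minGap_le {Nc : ℕ} (lam : Fin Nc → ℕ → ℝ) (L : Fin Nc → ℕ) (i : Fin Nc) {j : ℕ}
    (hj : j < L i) : minGap lam L ≤ relGap (lam i) j :=
  ciInf_le (Set.finite_range _).bddBelow (⟨i, j, hj⟩ : (i : Fin Nc) × Fin (L i))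

/-- For `Nc = 0` the index type is empty and the real infimum is 0 by convention, so nonnegativity
persists. -/
theorem minGap_nonneg {Nc : ℕ} {lam : Fin Nc → ℕ → ℝ} {L : Fin Nc → ℕ}
    (hpos : ∀ i j, 0 < lam i j) (hanti : ∀ i, Antitone (lam i)) : 0 ≤ minGap lam L :=
  Real.iInf_nonneg fun p =>
    div_nonneg (sub_nonneg.2 (hanti p.1 (Nat.le_succ _))) (hpos _ _).le

end Main

end LKSI

theorem mainTheorem4 {𝕜 : Type*} [RCLike 𝕜] {d m : ℕ}
    {Ω : Set (EuclideanSpace ℝ (Fin d))}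
    -- the Hilbert space `V`, compactly embedded in `L²(Ω)`
    {V : Type*} [NormedAddCommGroup V] [InnerProductSpace 𝕜 V] [CompleteSpace V]
    (emb : V →L[𝕜] LKSI.L2 𝕜 m Ω) (hinj : Function.Injective emb) (hcomp : IsCompactOperator emb)
    -- the symmetric, positive definite form of the operator `𝓛`
    (a : V →L⋆[𝕜] V →L[𝕜] 𝕜) (ha : LKSI.IsSymmCoercive a)
    -- the open cover
    {Nc : ℕ} (ω : Fin Nc → Set (EuclideanSpace ℝ (Fin d)))
    (hωo : ∀ i, IsOpen (ω i)) (hcov : ⋃ i, ω i = Ω)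
    -- the local eigenpairs
    (lam : Fin Nc → ℕ → ℝ) (φ : Fin Nc → ℕ → V)
    (hφ : ∀ i, LKSI.IsLocalEigenSystem emb a (ω i) (lam i) (φ i))
    (L : Fin Nc → ℕ) (hL : ∀ i, 1 ≤ L i)
    -- the Krylov iterates; `ψ_i^0` is not orthogonal to the first `L_i` eigenfunctions
    (ψ : Fin Nc → ℕ → V) (hψ : ∀ i, LKSI.IsKrylovIteration emb a (ω i) (ψ i))
    (hangle : ∀ i, ∀ j < L i, inner 𝕜 (emb (φ i j)) (emb (ψ i 0)) ≠ 0) :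
    ∃ C : ℝ, 0 ≤ C ∧
      ∀ (χ : Fin Nc → EuclideanSpace ℝ (Fin d) → ℝ), LKSI.IsPartitionOfUnity Ω ω χ →
      ∀ (n : ℕ) (f : LKSI.L2 𝕜 m Ω) (u uK : V),
        LKSI.IsVarSolution emb a ⊤ f u →
        LKSI.IsVarSolution emb a (LKSI.krylovSpace 𝕜 ψ n) f uK →
      -- `w i = χ_i u ∈ V` and `g i = 𝓛 χ_i u ∈ L²(Ω)`
      ∀ (w : Fin Nc → V) (g : Fin Nc → LKSI.L2 𝕜 m Ω),
        (∀ i, ∀ᵐ x ∂(volume.restrict Ω), emb (w i) x = (χ i x : 𝕜) • emb u x) →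
        (∀ i, LKSI.IsVarSolution emb a (LKSI.localSpace emb (ω i)) (g i) (w i)) →
        LKSI.energyNorm a (u - uK) ≤
          Real.sqrt (LKSI.lamMax lam L) * ∑ i, ‖g i‖ +
            C * (1 / (1 + 4 * LKSI.minGap lam L)) ^ n * ‖emb u‖ := by
  have hΩ : MeasurableSet Ω := by
    rw [← hcov]
    exact (isOpen_iUnion hωo).measurableSet
  have hpos : ∀ i j, 0 < lam i j := fun i j => by
    obtain ⟨G, hG⟩ := LKSI.exists_isSolutionOperator emb ha
      (LKSI.isClosed_localSpace emb (hωo i).measurableSet)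
    exact ((hφ i).isEigenEnumeration ha hG).lam_pos hG ha j
  have hγ : 0 ≤ LKSI.minGap lam L := LKSI.minGap_nonneg hpos fun i => (hφ i).antitone
  have hloc := fun i => LKSI.exists_local_approx hcomp ha (hωo i).measurableSet (hφ i) (hψ i)
    (hangle i) hγ (fun j hj => LKSI.minGap_le lam L i hj)
  -- The constants are fixed before `χ`, `n`, `f` and `u` appear, which gives the claimed
  -- independence.
  choose C hC hCv using hloc
  obtain ⟨q, hq⟩ := ha.exists_seminorm
  refine ⟨∑ i, C i, Finset.sum_nonneg fun i _ => hC i, ?_⟩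
  intro χ hχ n f u uK hu huK w g hw hg
  choose v hvmem hv using fun i => hCv i n (g i) (w i) (hg i)
  -- The partition of unity gives this identity only in $L^2$; injectivity of `emb` lifts it to `V`.
  have hsum : ∑ i, w i = u := hinj (by rw [map_sum]; exact hχ.sum_eq hΩ hw)
  have hvK : ∑ i, v i ∈ LKSI.krylovSpace 𝕜 ψ n :=
    Submodule.sum_mem _ fun i _ => LKSI.span_le_krylovSpace ψ n i (hvmem i)
  refine (LKSI.energyNorm_sub_galerkin_le ha hu huK hvK).trans ?_
  have hdiff : u - ∑ i, v i = ∑ i, (w i - v i) := by rw [Finset.sum_sub_distrib, hsum]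
  rw [hdiff, ← hq, Finset.mul_sum, Finset.sum_mul, Finset.sum_mul, ← Finset.sum_add_distrib]
  refine (Finset.le_sum_of_subadditive q (map_zero q).le (map_add_le_add q) _ _).trans (Finset.sum_le_sum fun i _ => ?_)
  rw [hq]
  have hlam : lam i (L i) ≤ LKSI.lamMax lam L :=
    le_ciSup (f := fun i => lam i (L i)) (Set.finite_range _).bddAbove i
  refine (hv i).trans (add_le_add ?_ ?_)
  · exact mul_le_mul_of_nonneg_right (Real.sqrt_le_sqrt hlam) (norm_nonneg _)
  · exact mul_le_mul_of_nonneg_left (hχ.norm_le hΩ i (hw i)) (mul_nonneg (hC i) (by positivity))
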